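/- Let $X,Y$ be complex Banach spaces, let $A\in B(X)$, $B\in B(Y)$ and $C\in B(Y,X)$ be bounded linear operators, and let $M_C=\begin{pmatrix}A&C\\0&B\end{pmatrix}\in B(X\oplus Y)$, i.e. $M_C(x,y)=(Ax+Cy,By)$. For a bounded operator $T$ on a complex Banach space $Z$, with kernel $N(T)$ and range $R(T)$: - the ascent $\mathrm{asc}(T)$ (resp. descent $\mathrm{des}(T)$) is the smallest integer $k\ge 0$ with $N(T^k)=N(T^{k+1})$ (resp. $R(T^k)=R(T^{k+1})$), and $\infty$ if there is no such $k$; - $T$ is a Browder operator if $\dim N(T)<\infty$, $\dim Z/R(T)<\infty$ and $\mathrm{asc}(T)=\mathrm{des}(T)<\infty$, and the Browder spectrum is $\sigma_b(T)=\{\lambda\in\mathbb{C}: T-\lambda I \text{ is not a Browder operator}\}$; - $T$ has the single valued extension property at $\lambda\in\mathbb{C}$ if there is $r>0$ such that for every open set $V\subseteq\{\mu\in\mathbb{C}:|\mu-\lambda|<r\}$ the only analytic $f:V\to Z$ with $(T-\mu I)f(\mu)=0$ for all $\mu\in V$ is $f\equiv 0$, and $S(T)$ is the set of all $\lambda\in\mathbb{C}$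 at which $T$ does not have this property. Let $A^*\in B(X^*)$ be the dual operator $\varphi\mapsto\varphi\circ A$ of $A$. Then $$\sigma_b(M_C)\cup\bigl(S(A^*)\cap S(B)\bigr)=\sigma_b(A)\cup\sigma_b(B).$$ -/

import Mathlib

namespace BrowderTheory

section Operator

variable {X : Type*} [NormedAddCommGroup X] [NormedSpace ℂ X]

/-- The ascent of `T`: the smallest `k` with `N(T ^ k) = N(T ^ (k + 1))`, and `⊤` if there is no
such `k` (the infimum in `ℕ∞` of the empty set is `⊤`). -/
noncomputable def ascent (T : X →L[ℂ] X) : ℕ∞ :=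
  sInf {n : ℕ∞ | ∃ k : ℕ, n = k ∧ (T ^ k).ker = (T ^ (k + 1)).ker}

/-- The descent of `T`: the smallest `k` with `R(T ^ k) = R(T ^ (k + 1))`, and `⊤` if there is no
such `k`. -/
noncomputable def descent (T : X →L[ℂ] X) : ℕ∞ :=
  sInf {n : ℕ∞ | ∃ k : ℕ, n = k ∧ (T ^ k).range = (T ^ (k + 1)).range}

/-- `T` is a Fredholm operator: `dim N(T) < ∞` and `dim X / R(T) < ∞`.
On a Banach space this already forces the range to be closed. -/
def IsFredholmOp (T : X →L[ℂ] X) : Prop :=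
  FiniteDimensional ℂ T.ker ∧ FiniteDimensional ℂ (X ⧸ T.range)

/-- `T` is a Browder operator: it is Fredholm and its ascent and descent are equal and finite. -/
def IsBrowder (T : X →L[ℂ] X) : Prop :=
  IsFredholmOp T ∧ ascent T = descent T ∧ descent T < ⊤

/-- The Browder spectrum of `T`: all `z` such that `T - z I` is not a Browder operator. -/
def browderSpectrum (T : X →L[ℂ] X) : Set ℂ :=
  {z | ¬ IsBrowder (T - z • ContinuousLinearMap.id ℂ X)}

/-- `T` has the single valued extension property at `z`: there is `r > 0` such that on every open
`V ⊆ D(z, r)` the only analytic solution `f : V → X` of `(T - w) f(w) = 0` is `f = 0`. -/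
def HasSVEPAt (T : X →L[ℂ] X) (z : ℂ) : Prop :=
  ∃ r : ℝ, 0 < r ∧ ∀ V : Set ℂ, IsOpen V → V ⊆ Metric.ball z r →
    ∀ f : ℂ → X, AnalyticOnNhd ℂ f V →
      (∀ w ∈ V, (T - w • ContinuousLinearMap.id ℂ X) (f w) = 0) → ∀ w ∈ V, f w = 0

/-- The set `S(T)` of all points at which `T` fails to have the single valued extension
property. -/
def svepFailureSet (T : X →L[ℂ] X) : Set ℂ :=
  {z | ¬ HasSVEPAt T z}

/-- The dual operator `T* : X* → X*`, `φ ↦ φ ∘ T`, on the Banach space `X*` of bounded linear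
functionals. -/
noncomputable def dualOp (T : X →L[ℂ] X) : StrongDual ℂ X →L[ℂ] StrongDual ℂ X :=
  ContinuousLinearMap.precomp ℂ T

end Operator

/-- The upper triangular operator matrix `M_C = [[A, C], [0, B]]` on `X ⊕ Y`, that is
`(x, y) ↦ (A x + C y, B y)`. -/
noncomputable def upperTriangular {X Y : Type*} [NormedAddCommGroup X] [NormedSpace ℂ X]
    [NormedAddCommGroup Y] [NormedSpace ℂ Y]
    (A : X →L[ℂ] X) (B : Y →L[ℂ] Y) (C : Y →L[ℂ] X) : (X × Y) →L[ℂ] (X × Y) :=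
  (A.coprod C).prod (B ∘L ContinuousLinearMap.snd ℂ X Y)

end BrowderTheory

/-!
Translating by `z`, write `A`, `B`, `M` for the operators minus `z`. The identity says that `A` and
`B` are Browder iff `M` is Browder and `A*` or `B` has the single valued extension property (SVEP)
at `z`.

*Algebra.* If ascent and descent of `T` are finite, they are equal and `X = N(T ^ n) ⊕ R(T ^ n)` for
large `n`; hence `T` is Browder as soon as `N(T)` is finite-dimensional or `R(T)` has finite
codimension (`isBrowder_of_fg_ker`, `isBrowder_of_cofg_range`). As `A` is the restriction of `M` to
the invariant subspace `X` and `B` is induced by `M` on the quotient by `X`, finite ascent and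
finite descent pass from `A` and `B` to `M`. Conversely, from a Browder `M`, finite ascent and
finite-dimensional kernel pass to `A`, and finite descent and finite-codimensional range pass to
`B`. Furthermore `A` has finite descent iff `B` has finite ascent
(`descent_lt_top_of_upperTriangular_of_ascent`, `ascent_lt_top_of_upperTriangular_of_descent`), and
in that case both are Browder (`IsBrowder.diagonal_of_ascent`).

*Analysis.* A Browder operator is bounded below on the range of one of its powers, which excludes
eigenvalues in a punctured neighbourhood of `z` and so gives SVEP (`hasSVEPAt_of_norm_pow_le`). In
the other direction, finite descent and SVEP imply finite ascent (`HasSVEPAt.ascent_lt_top`): an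
element of `N(T) ∩ R(T ^ q)` starts a backward orbit of geometric growth, whose generating function
is an analytic eigenvector. Applied to `B`, whose descent is finite, this settles the case that `B`
has SVEP. Applied to `A*`, whose descent is finite because `A` is bounded below on `R(A ^ n)`, it
gives finite ascent of `A*`; since `R(A ^ n)` is closed for large `n`, Hahn-Banach turns this into
finite descent of `A` (`descent_lt_top_of_ascent_dualOp`).
-/

namespace BrowderTheory

/-! ### Finite ascent and descent -/

section Operator

variable {X : Type*} [NormedAddCommGroup X] [NormedSpace ℂ X]

lemma pow_add_apply (T : X →L[ℂ] X) (m n : ℕ) (x : X) : (T ^ (m + n)) x = (T ^ m) ((T ^ n) x) := by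
  rw [pow_add, mul_apply_eq_comp]

lemma pow_eq_zero_of_ker_eq {T : X →L[ℂ] X} {p : ℕ} (h : (T ^ p).ker = (T ^ (p + 1)).ker)
    (k : ℕ) (x : X) (hx : (T ^ (p + k)) x = 0) : (T ^ p) x = 0 := by
  induction k generalizing x with
  | zero => exact hx
  | succ k ih =>
    have hx' : x ∈ (T ^ (p + 1)).ker := ih (T x) (by rwa [← add_assoc, pow_succ] at hx)
    rwa [← h] at hx'

lemma exists_pow_eq_of_range_eq {T : X →L[ℂ] X} {q : ℕ} (h : (T ^ q).range = (T ^ (q + 1)).range)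
    (k : ℕ) (x : X) : ∃ u, (T ^ q) x = (T ^ (k + q)) u := by
  induction k with
  | zero => exact ⟨x, by rw [zero_add]⟩
  | succ k ih =>
    obtain ⟨u, hu⟩ := ih
    obtain ⟨v, hv⟩ : (T ^ q) u ∈ (T ^ (q + 1)).range := h ▸ ⟨u, rfl⟩
    have hv : (T ^ (q + 1)) v = (T ^ q) u := hv
    exact ⟨v, by rw [hu, pow_add_apply, ← hv, ← pow_add_apply, add_assoc k, add_comm 1 q]⟩

lemma ker_pow_le_succ (T : X →L[ℂ] X) (p : ℕ) : (T ^ p).ker ≤ (T ^ (p + 1)).ker := fun x hx => by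
  have hx : (T ^ p) x = 0 := hx
  change (T ^ (p + 1)) x = 0
  rw [add_comm, pow_add_apply, hx, map_zero]

lemma range_pow_succ_le (T : X →L[ℂ] X) (q : ℕ) : (T ^ (q + 1)).range ≤ (T ^ q).range := by
  rintro _ ⟨x, rfl⟩
  exact ⟨T x, by rw [pow_succ]; rfl⟩

lemma exists_ascent_eq {T : X →L[ℂ] X} (h : ascent T < ⊤) :
    ∃ p : ℕ, ascent T = p ∧ (T ^ p).ker = (T ^ (p + 1)).ker := by
  obtain ⟨n, hn, -⟩ := sInf_lt_iff.mp h
  exact csInf_mem (s := {n : ℕ∞ | ∃ k : ℕ, n = k ∧ (T ^ k).ker = (T ^ (k + 1)).ker}) ⟨n, hn⟩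

lemma exists_descent_eq {T : X →L[ℂ] X} (h : descent T < ⊤) :
    ∃ q : ℕ, descent T = q ∧ (T ^ q).range = (T ^ (q + 1)).range := by
  obtain ⟨n, hn, -⟩ := sInf_lt_iff.mp h
  exact csInf_mem (s := {n : ℕ∞ | ∃ k : ℕ, n = k ∧ (T ^ k).range = (T ^ (k + 1)).range}) ⟨n, hn⟩

/-- The ascent is finite iff the kernels of all powers lie in that of a fixed power. -/
lemma ascent_lt_top_iff (T : X →L[ℂ] X) :
    ascent T < ⊤ ↔ ∃ p : ℕ, ∀ (k : ℕ) (x : X), (T ^ k) x = 0 → (T ^ p) x = 0 := by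
  constructor
  · intro h
    obtain ⟨p, -, hp⟩ := exists_ascent_eq h
    exact ⟨p, fun k x hx => pow_eq_zero_of_ker_eq hp k x (by rw [pow_add_apply, hx, map_zero])⟩
  · rintro ⟨p, hp⟩
    exact sInf_lt_iff.mpr ⟨p, ⟨p, rfl, le_antisymm (ker_pow_le_succ T p) (fun x hx => hp _ x hx)⟩,
      ENat.natCast_lt_top p⟩

/-- The descent is finite iff the range of a fixed power lies in those of all powers. -/
lemma descent_lt_top_iff (T : X →L[ℂ] X) :
    descent T < ⊤ ↔ ∃ q : ℕ, ∀ (k : ℕ) (x : X), ∃ u, (T ^ q) x = (T ^ k) u := by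
  constructor
  · intro h
    obtain ⟨q, -, hq⟩ := exists_descent_eq h
    refine ⟨q, fun k x => ?_⟩
    obtain ⟨u, hu⟩ := exists_pow_eq_of_range_eq hq k x
    exact ⟨(T ^ q) u, by rw [hu, pow_add_apply]⟩
  · rintro ⟨q, hq⟩
    refine sInf_lt_iff.mpr ⟨q, ⟨q, rfl, le_antisymm ?_ (range_pow_succ_le T q)⟩,
      ENat.natCast_lt_top q⟩
    rintro _ ⟨x, rfl⟩
    obtain ⟨u, hu⟩ := hq (q + 1) x
    exact ⟨u, hu.symm⟩

/-- If ascent and descent are both finite, they coincide. -/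
lemma ascent_eq_descent {T : X →L[ℂ] X} (ha : ascent T < ⊤) (hd : descent T < ⊤) :
    ascent T = descent T := by
  obtain ⟨p, hp, hker⟩ := exists_ascent_eq ha
  obtain ⟨q, hq, hran⟩ := exists_descent_eq hd
  apply le_antisymm
  · rw [hq]
    refine sInf_le ⟨q, rfl, le_antisymm (ker_pow_le_succ T q) (fun x hx => ?_)⟩
    have hx : (T ^ (q + 1)) x = 0 := hx
    change (T ^ q) x = 0
    obtain ⟨u, hu⟩ := exists_pow_eq_of_range_eq hran p x
    have hu' : (T ^ (p + (q + 1))) u = 0 := by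
      rw [← add_assoc, add_comm (p + q), pow_add_apply, ← hu, ← pow_add_apply, add_comm, hx]
    rw [hu, add_comm, pow_add_apply, pow_eq_zero_of_ker_eq hker _ u hu', map_zero]
  · rw [hp]
    refine sInf_le ⟨p, rfl, le_antisymm ?_ (range_pow_succ_le T p)⟩
    rintro _ ⟨x, rfl⟩
    obtain ⟨u, hu⟩ := exists_pow_eq_of_range_eq hran 1 x
    have h0 : (T ^ (p + q)) (x - T u) = 0 := by
      rw [map_sub, pow_add_apply, hu, add_comm 1 q, pow_add_apply T q 1, pow_one, ← pow_add_apply,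
        sub_self]
    have h1 := pow_eq_zero_of_ker_eq hker q _ h0
    rw [map_sub, sub_eq_zero] at h1
    exact ⟨u, by rw [pow_succ]; exact h1.symm⟩

/-- With finite ascent and descent, `X = N(T ^ m) ⊕ R(T ^ m)` for all large `m`, and the
kernels of the powers of `T` are stationary from there on. -/
lemma exists_isCompl_ker_range {T : X →L[ℂ] X} (ha : ascent T < ⊤) (hd : descent T < ⊤) :
    ∃ n : ℕ, (∀ (k : ℕ) (x : X), (T ^ k) x = 0 → (T ^ n) x = 0) ∧
      ∀ m, n ≤ m → IsCompl (T ^ m).ker (T ^ m).range := by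
  obtain ⟨p, hp⟩ := (ascent_lt_top_iff T).mp ha
  obtain ⟨q, hq⟩ := (descent_lt_top_iff T).mp hd
  have hpn : ∀ m, p ≤ m → ∀ (k : ℕ) (x : X), (T ^ k) x = 0 → (T ^ m) x = 0 := by
    intro m hm k x hx
    obtain ⟨j, rfl⟩ := Nat.exists_eq_add_of_le hm
    rw [add_comm, pow_add_apply, hp k x hx, map_zero]
  refine ⟨p + q, hpn _ (Nat.le_add_right _ _), fun m hm => ⟨?_, ?_⟩⟩
  · rw [Submodule.disjoint_def]
    rintro _ hx ⟨u, rfl⟩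
    have hx : (T ^ m) ((T ^ m) u) = 0 := hx
    rw [← pow_add_apply] at hx
    exact hpn m (by omega) _ u hx
  · rw [codisjoint_iff, eq_top_iff]
    rintro x -
    obtain ⟨j, rfl⟩ := Nat.exists_eq_add_of_le' (show q ≤ m by omega)
    obtain ⟨u, hu⟩ := hq (q + (j + q)) x
    refine Submodule.mem_sup.mpr ⟨x - (T ^ (j + q)) u, ?_, (T ^ (j + q)) u, ⟨u, rfl⟩, by simp⟩
    change (T ^ (j + q)) (x - (T ^ (j + q)) u) = 0
    rw [map_sub, sub_eq_zero, pow_add_apply T j q x, hu, ← pow_add_apply, ← pow_add_apply,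
      add_assoc j q]

end Operator

/-! ### Browder operators -/

section Operator

variable {X : Type*} [NormedAddCommGroup X] [NormedSpace ℂ X]

lemma fg_ker_pow {T : X →L[ℂ] X} (h : T.ker.FG) (n : ℕ) : (T ^ n).ker.FG := by
  induction n with
  | zero =>
    convert Submodule.fg_bot
    exact (Submodule.eq_bot_iff _).mpr fun x hx => hx
  | succ n ih =>
    refine Submodule.fg_of_fg_map_of_fg_inf_ker (T : X →ₗ[ℂ] X) ?_ ?_
    · refine Submodule.FG.of_le ih ?_
      rintro _ ⟨x, hx, rfl⟩
      rw [pow_succ] at hx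
      exact hx
    · exact Submodule.FG.of_le h inf_le_right

lemma cofg_range_pow {T : X →L[ℂ] X} (h : T.range.CoFG) (n : ℕ) : (T ^ n).range.CoFG := by
  obtain ⟨S, hS⟩ := Submodule.exists_isCompl T.range
  have hSfg : S.FG := h.fg_of_isCompl hS
  suffices ∃ S' : Submodule ℂ X, S'.FG ∧ Codisjoint S' (T ^ n).range by
    obtain ⟨S', h1, h2⟩ := this
    exact h1.cofg_of_codisjoint h2
  induction n with
  | zero =>
    refine ⟨⊥, Submodule.fg_bot, ?_⟩
    rw [codisjoint_iff, bot_sup_eq, eq_top_iff]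
    exact fun x _ => ⟨x, rfl⟩
  | succ n ih =>
    obtain ⟨S', h1, h2⟩ := ih
    refine ⟨S ⊔ S'.map (T : X →ₗ[ℂ] X), hSfg.sup (h1.map _), ?_⟩
    rw [codisjoint_iff, eq_top_iff]
    rintro x -
    obtain ⟨_, ⟨y, rfl⟩, s, hs, rfl⟩ :=
      Submodule.mem_sup.mp (hS.sup_eq_top ▸ Submodule.mem_top : x ∈ _)
    obtain ⟨s', hs', _, ⟨u, rfl⟩, rfl⟩ :=
      Submodule.mem_sup.mp (h2.eq_top ▸ Submodule.mem_top : y ∈ _)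
    refine Submodule.mem_sup.mpr ⟨s + T s', Submodule.add_mem_sup hs ⟨s', hs', rfl⟩,
      (T ^ (n + 1)) u, ⟨u, rfl⟩, ?_⟩
    have hu : (T ^ (n + 1)) u = T ((T ^ n) u) := by rw [pow_succ', mul_apply_eq_comp]
    change s + T s' + (T ^ (n + 1)) u = T (s' + (T ^ n) u) + s
    rw [hu, map_add]
    abel

lemma IsBrowder.ascent_lt_top {T : X →L[ℂ] X} (h : IsBrowder T) : ascent T < ⊤ := h.2.1 ▸ h.2.2

lemma IsBrowder.fg_ker {T : X →L[ℂ] X} (h : IsBrowder T) : T.ker.FG :=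
  (Submodule.fg_iff_finiteDimensional _).mpr h.1.1

/-- For an operator of finite ascent and descent, a finite-dimensional kernel suffices to be
Browder. -/
lemma isBrowder_of_fg_ker {T : X →L[ℂ] X} (ha : ascent T < ⊤) (hd : descent T < ⊤)
    (h : T.ker.FG) : IsBrowder T := by
  refine ⟨⟨(Submodule.fg_iff_finiteDimensional _).mp h, ?_⟩, ascent_eq_descent ha hd, hd⟩
  obtain ⟨n, -, hn⟩ := exists_isCompl_ker_range ha hd
  have hle : (T ^ (n + 1)).range ≤ T.range := by
    rintro _ ⟨x, rfl⟩
    exact ⟨(T ^ n) x, by rw [pow_succ']; rfl⟩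
  have hc := (fg_ker_pow h (n + 1)).cofg_of_isCompl (hn (n + 1) n.le_succ)
  exact hc.of_le hle

/-- For an operator of finite ascent and descent, a range of finite codimension suffices to be
Browder. -/
lemma isBrowder_of_cofg_range {T : X →L[ℂ] X} (ha : ascent T < ⊤) (hd : descent T < ⊤)
    (h : T.range.CoFG) : IsBrowder T := by
  refine isBrowder_of_fg_ker ha hd ?_
  obtain ⟨n, -, hn⟩ := exists_isCompl_ker_range ha hd
  have hle : T.ker ≤ (T ^ (n + 1)).ker := fun x hx => by
    change (T ^ (n + 1)) x = 0
    have hx : T x = 0 := hx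
    rw [pow_add_apply, pow_one, hx, map_zero]
  exact ((cofg_range_pow h (n + 1)).fg_of_isCompl (hn (n + 1) n.le_succ).symm).of_le hle

/-- If `X = N(P) ⊕ R(P)` then `(u, k) ↦ P u + k` maps `X × N(P)` onto `X`; the open mapping
theorem for this map takes the place of the closedness of `R(P)`. -/
lemma surjective_coprod_ker {P : X →L[ℂ] X} (h : IsCompl P.ker P.range) :
    Function.Surjective (P.coprod P.ker.subtypeL) := by
  intro x
  obtain ⟨k, hk, _, ⟨u, rfl⟩, rfl⟩ :=
    Submodule.mem_sup.mp (h.sup_eq_top ▸ Submodule.mem_top : x ∈ _)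
  exact ⟨(u, ⟨k, hk⟩), add_comm (P u) k⟩

lemma eq_zero_of_apply_add_eq {P : X →L[ℂ] X} (h : IsCompl P.ker P.range) {u x : X} {k : P.ker}
    (hk : P u + k = P x) : (k : X) = 0 := by
  have hk' : P (x - u) = k := by rw [map_sub, ← hk]; abel
  exact Submodule.disjoint_def.mp h.disjoint _ k.2 ⟨x - u, hk'⟩

/-- Some power `T ^ n` of a Browder operator has a range on which `T` is bounded below. -/
lemma IsBrowder.exists_norm_pow_le [CompleteSpace X] {T : X →L[ℂ] X} (h : IsBrowder T) :
    ∃ n : ℕ, ∃ K : ℝ, 0 < K ∧ ∀ x, ‖(T ^ n) x‖ ≤ K * ‖(T ^ (n + 1)) x‖ := by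
  obtain ⟨n, hn, hc⟩ := exists_isCompl_ker_range h.ascent_lt_top h.2.2
  have hc := hc (n + 1) n.le_succ
  have hfin : FiniteDimensional ℂ (T ^ (n + 1)).ker :=
    (Submodule.fg_iff_finiteDimensional _).mp (fg_ker_pow h.fg_ker _)
  have : CompleteSpace (T ^ (n + 1)).ker := FiniteDimensional.complete ℂ _
  obtain ⟨D, hD, hpre⟩ := ContinuousLinearMap.exists_preimage_norm_le _ (surjective_coprod_ker hc)
  refine ⟨n, (‖T ^ n‖ + 1) * D, by positivity, fun x => ?_⟩
  -- The preimage `u` of `T ^ (n + 1) x` is controlled by `T ^ (n + 1) x`, and `T ^ n u = T ^ n x`.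
  obtain ⟨⟨u, k⟩, hu, hbd⟩ := hpre ((T ^ (n + 1)) x)
  have hu : (T ^ (n + 1)) u + (k : X) = (T ^ (n + 1)) x := hu
  have hxu : (T ^ n) x = (T ^ n) u := by
    rw [← sub_eq_zero, ← map_sub]
    refine hn (n + 1) _ ?_
    rw [map_sub, ← hu, eq_zero_of_apply_add_eq hc hu, add_zero, sub_self]
  calc ‖(T ^ n) x‖ = ‖(T ^ n) u‖ := by rw [hxu]
    _ ≤ ‖T ^ n‖ * ‖u‖ := (T ^ n).le_opNorm u
    _ ≤ (‖T ^ n‖ + 1) * (D * ‖(T ^ (n + 1)) x‖) := by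
        gcongr
        · linarith
        · exact (norm_fst_le (u, k)).trans hbd
    _ = _ := by ring

/-- High powers of a Browder operator map closed subspaces onto closed subspaces. -/
lemma IsBrowder.exists_isClosed_map [CompleteSpace X] {T : X →L[ℂ] X} (h : IsBrowder T) :
    ∃ n : ℕ, ∀ m, n ≤ m → ∀ S : Submodule ℂ X, IsClosed (S : Set X) →
      IsClosed (S.map ((T ^ m : X →L[ℂ] X) : X →ₗ[ℂ] X) : Set X) := by
  obtain ⟨n, -, hc⟩ := exists_isCompl_ker_range h.ascent_lt_top h.2.2
  refine ⟨n, fun m hm S hS => ?_⟩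
  have hc := hc m hm
  have hfin : FiniteDimensional ℂ (T ^ m).ker :=
    (Submodule.fg_iff_finiteDimensional _).mp (fg_ker_pow h.fg_ker _)
  have : CompleteSpace (T ^ m).ker := FiniteDimensional.complete ℂ _
  rw [← (ContinuousLinearMap.isQuotientMap _ (surjective_coprod_ker hc)).isClosed_preimage]
  -- The preimage of `T ^ m S` under `(u, k) ↦ T ^ m u + k` is `(S + N(T ^ m)) × {0}`.
  have hpre : ((T ^ m).coprod (T ^ m).ker.subtypeL) ⁻¹'
      (S.map ((T ^ m : X →L[ℂ] X) : X →ₗ[ℂ] X) : Set X) =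
        ((S ⊔ (T ^ m).ker : Submodule ℂ X) : Set X) ×ˢ {0} := by
    refine Set.ext fun ⟨u, k⟩ => ?_
    constructor
    · rintro ⟨s, hs, hsu⟩
      have hsu : (T ^ m) u + (k : X) = (T ^ m) s := hsu.symm
      have hk0 := eq_zero_of_apply_add_eq hc hsu
      refine ⟨Submodule.mem_sup.mpr ⟨s, hs, u - s, ?_, by abel⟩, Subtype.ext hk0⟩
      change (T ^ m) (u - s) = 0
      rw [map_sub, ← hsu, hk0, add_zero, sub_self]
    · rintro ⟨hu, hk⟩
      obtain ⟨s, hs, v, hv, hsv⟩ := Submodule.mem_sup.mp hu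
      have hv : (T ^ m) v = 0 := hv
      have hsv : s + v = u := hsv
      have hk : k = 0 := hk
      refine ⟨s, hs, ?_⟩
      change (T ^ m) s = (T ^ m) u + (k : X)
      rw [← hsv, hk, map_add, hv, add_zero, Submodule.coe_zero, add_zero]
  rw [hpre]
  exact (Submodule.isClosed_sup_finiteDimensional S _ hS).prod isClosed_singleton

end Operator

/-! ### The single valued extension property -/

section Operator

variable {X : Type*} [NormedAddCommGroup X] [NormedSpace ℂ X]

/-- A backward orbit of geometric growth starting in the kernel of `T - z` is trivial if `T` has
the single valued extension property at `z`: its generating function is analytic near `z` and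
annihilated by `T - w`. -/
lemma HasSVEPAt.eq_zero_of_backward_orbit [CompleteSpace X] {T : X →L[ℂ] X} {z : ℂ}
    (h : HasSVEPAt T z) {y : ℕ → X} {D K : ℝ} (hK : 0 < K) (hy : ∀ n, ‖y n‖ ≤ D * K ^ n)
    (h0 : (T - z • ContinuousLinearMap.id ℂ X) (y 0) = 0)
    (hs : ∀ n, (T - z • ContinuousLinearMap.id ℂ X) (y (n + 1)) = y n) : y 0 = 0 := by
  obtain ⟨r, hr, hV⟩ := h
  set S := T - z • ContinuousLinearMap.id ℂ X with hS
  set ρ : ℝ := min r (1 / (2 * K)) with hρ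
  have hρ0 : 0 < ρ := lt_min hr (by positivity)
  have hD : 0 ≤ D := by simpa using (norm_nonneg _).trans (hy 0)
  have hbound : ∀ n, ∀ w ∈ Metric.ball z ρ, ‖(w - z) ^ n • y n‖ ≤ D * (1 / 2) ^ n := by
    intro n w hw
    have hw' : ‖w - z‖ ≤ 1 / (2 * K) :=
      ((mem_ball_iff_norm.mp hw).trans_le (min_le_right _ _)).le
    calc ‖(w - z) ^ n • y n‖ = ‖w - z‖ ^ n * ‖y n‖ := by rw [norm_smul, norm_pow]
      _ ≤ (1 / (2 * K)) ^ n * (D * K ^ n) := by gcongr; exact hy n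
      _ = D * (1 / (2 * K) * K) ^ n := by rw [mul_pow]; ring
      _ = D * (1 / 2) ^ n := by congr 2; field_simp
  have hsum : Summable fun n : ℕ => D * (1 / 2 : ℝ) ^ n :=
    (summable_geometric_of_lt_one (by norm_num) (by norm_num)).mul_left D
  let f : ℂ → X := fun w => ∑' n, (w - z) ^ n • y n
  have hf : AnalyticOnNhd ℂ f (Metric.ball z ρ) := by
    refine DifferentiableOn.analyticOnNhd ?_ Metric.isOpen_ball
    exact Complex.differentiableOn_tsum_of_summable_norm hsum (fun n => by fun_prop)
      Metric.isOpen_ball hbound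
  have hker : ∀ w ∈ Metric.ball z ρ, (T - w • ContinuousLinearMap.id ℂ X) (f w) = 0 := by
    intro w hw
    have hfs : Summable fun n => (w - z) ^ n • y n :=
      Summable.of_norm_bounded hsum fun n => hbound n w hw
    have hTS : (T - w • ContinuousLinearMap.id ℂ X) (f w) = S (f w) - (w - z) • f w := by
      simp [hS, sub_smul]
    have h1 : S (f w) = ∑' n, (w - z) ^ (n + 1) • y n := by
      change S (∑' n, (w - z) ^ n • y n) = _
      rw [S.map_tsum hfs, (hfs.mapL S).tsum_eq_zero_add]
      simp only [map_smul, h0, hs, smul_zero, zero_add]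
    have h2 : (w - z) • f w = ∑' n, (w - z) ^ (n + 1) • y n := by
      change (w - z) • (∑' n, (w - z) ^ n • y n) = _
      rw [← hfs.tsum_const_smul]
      simp only [smul_smul, pow_succ']
    rw [hTS, h1, h2, sub_self]
  have hz : z ∈ Metric.ball z ρ := Metric.mem_ball_self hρ0
  have := hV _ Metric.isOpen_ball (Metric.ball_subset_ball (min_le_left _ _)) f hf hker z hz
  have hfz : f z = y 0 := by
    change ∑' n, (z - z) ^ n • y n = _
    rw [tsum_eq_single 0 (fun n hn => by simp [hn])]
    simp
  rw [← hfz, this]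

/-- With finite descent, the single valued extension property at `z` forces finite ascent of
`T - z`. By the open mapping theorem, elements of `R(S ^ q)` (with `S = T - z`) have preimages in
`R(S ^ q)` with control of the norms, so that every element of `R(S ^ q) ∩ N(S)` starts a backward
orbit of geometric growth. -/
lemma HasSVEPAt.ascent_lt_top [CompleteSpace X] {T : X →L[ℂ] X} {z : ℂ} (h : HasSVEPAt T z)
    (hd : descent (T - z • ContinuousLinearMap.id ℂ X) < ⊤) :
    ascent (T - z • ContinuousLinearMap.id ℂ X) < ⊤ := by
  set S := T - z • ContinuousLinearMap.id ℂ X with hS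
  obtain ⟨q, -, hq⟩ := exists_descent_eq hd
  -- The range of `S ^ q` need not be closed: the open mapping theorem is applied to the first
  -- projection on the closed relation `S ^ q x = S ^ (q + 1) u` instead.
  let E : Submodule ℂ (X × X) := ((S ^ q).coprod (-(S ^ (q + 1)))).ker
  have hE : IsClosed (E : Set (X × X)) := ContinuousLinearMap.isClosed_ker _
  have : CompleteSpace E := hE.completeSpace_coe
  let π : E →L[ℂ] X := (ContinuousLinearMap.fst ℂ X X).comp E.subtypeL
  have hπ : Function.Surjective π := by
    intro x
    obtain ⟨u, hu⟩ : (S ^ q) x ∈ (S ^ (q + 1)).range := hq ▸ ⟨x, rfl⟩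
    have hu : (S ^ (q + 1)) u = (S ^ q) x := hu
    refine ⟨⟨(x, u), ?_⟩, rfl⟩
    change (S ^ q) x + -(S ^ (q + 1)) u = 0
    rw [hu, add_neg_cancel]
  obtain ⟨K, hK, hpre⟩ := π.exists_preimage_norm_le hπ
  have hstep : ∀ x, ∃ u, (S ^ (q + 1)) u = (S ^ q) x ∧ ‖u‖ ≤ K * ‖x‖ := by
    intro x
    obtain ⟨⟨⟨x', u⟩, hu⟩, rfl, hbd⟩ := hpre x
    have hu : (S ^ q) x' + -(S ^ (q + 1)) u = 0 := hu
    exact ⟨u, (add_neg_eq_zero.mp hu).symm, (norm_snd_le (x', u)).trans hbd⟩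
  choose g hg hgn using hstep
  refine sInf_lt_iff.mpr ⟨q, ⟨q, rfl, le_antisymm (ker_pow_le_succ S q) fun x hx => ?_⟩,
    ENat.natCast_lt_top q⟩
  have hx : (S ^ (q + 1)) x = 0 := hx
  have hgx : ∀ n, ‖g^[n] x‖ ≤ K ^ n * ‖x‖ := by
    intro n
    induction n with
    | zero => simp
    | succ n ih =>
      rw [Function.iterate_succ_apply', pow_succ', mul_assoc]
      exact (hgn _).trans (by gcongr)
  have hsucc : ∀ u, S ((S ^ q) u) = (S ^ (q + 1)) u := fun u => by
    rw [add_comm, pow_add_apply, pow_one]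
  refine h.eq_zero_of_backward_orbit (y := fun n => (S ^ q) (g^[n] x)) (D := ‖S ^ q‖ * ‖x‖) hK
    (fun n => ?_) ?_ (fun n => ?_)
  · calc ‖(S ^ q) (g^[n] x)‖ ≤ ‖S ^ q‖ * (K ^ n * ‖x‖) := (S ^ q).le_opNorm_of_le (hgx n)
      _ = _ := by ring
  · exact (hsucc x).trans hx
  · change S ((S ^ q) (g^[n + 1] x)) = _
    rw [hsucc, Function.iterate_succ_apply', hg]

/-- If `S = T - z` is bounded below on `R(S ^ n)`, then `T` has no eigenvalue near `z` other
than possibly `z` itself, since an eigenvector of `S` for a nonzero eigenvalue lies in `R(S ^ n)`. -/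
lemma hasSVEPAt_of_norm_pow_le {T : X →L[ℂ] X} {z : ℂ} {n : ℕ} {K : ℝ} (hK : 0 < K)
    (h : ∀ x, ‖((T - z • ContinuousLinearMap.id ℂ X) ^ n) x‖ ≤
      K * ‖((T - z • ContinuousLinearMap.id ℂ X) ^ (n + 1)) x‖) : HasSVEPAt T z := by
  set S := T - z • ContinuousLinearMap.id ℂ X with hS
  refine ⟨1 / K, by positivity, fun V hVo hV f hf hker => ?_⟩
  have hne : ∀ w ∈ V, w ≠ z → f w = 0 := by
    intro w hw hwz
    have hSf : S (f w) = (w - z) • f w := by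
      have := hker w hw
      have h2 : (T - w • ContinuousLinearMap.id ℂ X) (f w) = S (f w) - (w - z) • f w := by
        simp [hS, sub_smul]
      rwa [h2, sub_eq_zero] at this
    have hpow : ∀ k, (S ^ k) (f w) = (w - z) ^ k • f w := by
      intro k
      induction k with
      | zero => simp
      | succ k ih => rw [pow_add_apply, pow_one, hSf, map_smul, ih, smul_smul, pow_succ']
    have hle := h (f w)
    rw [hpow, hpow, norm_smul, norm_smul, norm_pow, norm_pow] at hle
    have hwz0 : 0 < ‖w - z‖ := norm_pos_iff.mpr (sub_ne_zero.mpr hwz)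
    have hwK : K * ‖w - z‖ < 1 := by
      have := mem_ball_iff_norm.mp (hV hw)
      rw [lt_div_iff₀ hK] at this
      linarith
    by_contra hfw
    have hpos : 0 < ‖w - z‖ ^ n * ‖f w‖ := mul_pos (pow_pos hwz0 n) (norm_pos_iff.mpr hfw)
    have : ‖w - z‖ ^ n * ‖f w‖ < 1 * (‖w - z‖ ^ n * ‖f w‖) := by
      calc _ ≤ _ := hle
        _ = (K * ‖w - z‖) * (‖w - z‖ ^ n * ‖f w‖) := by rw [pow_succ]; ring
        _ < _ := by gcongr
    linarith
  intro w hw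
  by_cases hwz : w = z
  · subst hwz
    -- At `z` itself, `f` vanishes by continuity.
    have hlim : Filter.Tendsto f (nhdsWithin w {w}ᶜ) (nhds (f w)) :=
      (hf w hw).continuousAt.tendsto.mono_left nhdsWithin_le_nhds
    have hev : ∀ᶠ v in nhdsWithin w {w}ᶜ, f v = 0 := by
      filter_upwards [mem_nhdsWithin_of_mem_nhds (hVo.mem_nhds hw), self_mem_nhdsWithin]
        with v hv hvw using hne v hv hvw
    exact tendsto_nhds_unique hlim (tendsto_const_nhds.congr' (hev.mono fun v hv => hv.symm))
  · exact hne w hw hwz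

end Operator

/-! ### The dual operator -/

section Dual

variable {X : Type*} [NormedAddCommGroup X] [NormedSpace ℂ X]

lemma dualOp_sub_smul_id (A : X →L[ℂ] X) (z : ℂ) :
    dualOp A - z • ContinuousLinearMap.id ℂ _ = dualOp (A - z • ContinuousLinearMap.id ℂ X) := by
  ext φ x
  change φ (A x) - z • φ x = φ (A x - z • x)
  rw [map_sub, map_smul]

lemma dualOp_pow_apply (A : X →L[ℂ] X) (n : ℕ) (φ : StrongDual ℂ X) (x : X) :
    ((dualOp A) ^ n) φ x = φ ((A ^ n) x) := by
  induction n generalizing x with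
  | zero => rfl
  | succ n ih =>
    rw [add_comm, pow_add_apply, add_comm, pow_add_apply A n 1, pow_one, pow_one]
    exact ih (A x)

/-- A functional dominated by `‖P x‖` lies in the range of the dual of `P`. -/
lemma exists_comp_eq_of_norm_le (P : X →L[ℂ] X) (ψ : StrongDual ℂ X) {D : ℝ}
    (h : ∀ x, ‖ψ x‖ ≤ D * ‖P x‖) : ∃ φ : StrongDual ℂ X, ∀ x, φ (P x) = ψ x := by
  have heq : ∀ x x', P x = P x' → ψ x = ψ x' := by
    intro x x' hxx
    have := h (x - x')
    rw [map_sub, map_sub, hxx, sub_self, norm_zero, mul_zero, norm_le_zero_iff] at this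
    exact sub_eq_zero.mp this
  have hsurj : ∀ y : P.range, ∃ x, P x = y := fun y => y.2
  choose g hg using hsurj
  let f : P.range →ₗ[ℂ] ℂ :=
    { toFun := fun y => ψ (g y)
      map_add' := fun y y' => by
        rw [← map_add]
        exact heq _ _ (by rw [hg, map_add, hg, hg]; rfl)
      map_smul' := fun c y => by
        rw [RingHom.id_apply, ← map_smul]
        exact heq _ _ (by rw [hg, map_smul, hg]; rfl) }
  obtain ⟨φ, hφ, -⟩ := exists_extension_norm_eq P.range (f.mkContinuous D fun y => by
    have := h (g y)
    rwa [hg] at this)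
  exact ⟨φ, fun x => (hφ ⟨P x, x, rfl⟩).trans (heq _ _ (hg _))⟩

/-- Boundedness below of `A` on `R(A ^ n)` makes every functional `φ ∘ A ^ n` factor through
`A ^ (n + 1)`. -/
lemma descent_dualOp_lt_top {A : X →L[ℂ] X} {n : ℕ} {K : ℝ}
    (h : ∀ x, ‖(A ^ n) x‖ ≤ K * ‖(A ^ (n + 1)) x‖) : descent (dualOp A) < ⊤ := by
  refine sInf_lt_iff.mpr ⟨n, ⟨n, rfl, le_antisymm ?_ (range_pow_succ_le _ n)⟩,
    ENat.natCast_lt_top n⟩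
  rintro _ ⟨φ, rfl⟩
  obtain ⟨φ', hφ'⟩ := exists_comp_eq_of_norm_le (A ^ (n + 1)) (((dualOp A) ^ n) φ)
    (D := ‖φ‖ * K) fun x => by
      rw [dualOp_pow_apply, mul_assoc]
      exact φ.le_opNorm_of_le (h x)
  exact ⟨φ', ContinuousLinearMap.ext fun x => (dualOp_pow_apply A _ φ' x).trans (hφ' x)⟩

lemma exists_dual_separating {S : Submodule ℂ X} (hS : IsClosed (S : Set X)) {x : X} (hx : x ∉ S) :
    ∃ φ : StrongDual ℂ X, (∀ y ∈ S, φ y = 0) ∧ φ x ≠ 0 := by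
  have := hS
  have hne : ‖S.mkQ x‖ ≠ 0 := by
    rw [norm_ne_zero_iff]
    exact fun h => hx ((Submodule.Quotient.mk_eq_zero S).mp h)
  obtain ⟨g, -, hg⟩ := exists_dual_vector ℂ (S.mkQ x) hne
  refine ⟨g.comp S.mkQL, fun y hy => ?_, fun h => hne ?_⟩
  · change g (S.mkQ y) = 0
    rw [show S.mkQ y = 0 from (Submodule.Quotient.mk_eq_zero S).mpr hy, map_zero]
  · have h : g (S.mkQ x) = 0 := h
    rw [hg] at h
    exact Complex.ofReal_eq_zero.mp h

/-- Finite ascent of the dual says that the ranges `R(A ^ m)` eventually have the same annihilator,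
hence, by Hahn-Banach, the same closure. -/
lemma descent_lt_top_of_ascent_dualOp {A : X →L[ℂ] X} {n : ℕ}
    (hcl : ∀ m, n ≤ m → IsClosed ((A ^ m).range : Set X)) (h : ascent (dualOp A) < ⊤) :
    descent A < ⊤ := by
  obtain ⟨p, hp⟩ := (ascent_lt_top_iff _).mp h
  refine sInf_lt_iff.mpr ⟨(p + n : ℕ), ⟨p + n, rfl, le_antisymm ?_ (range_pow_succ_le _ _)⟩,
    ENat.natCast_lt_top _⟩
  rintro _ ⟨x, rfl⟩
  by_contra hx
  obtain ⟨φ, hφ, hφx⟩ := exists_dual_separating (hcl _ (by omega)) hx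
  refine hφx ?_
  have h0 : ((dualOp A) ^ (p + n + 1)) φ = 0 :=
    ContinuousLinearMap.ext fun y => (dualOp_pow_apply A _ φ y).trans (hφ _ ⟨y, rfl⟩)
  have h1 := hp _ φ h0
  change φ ((A ^ (p + n)) x) = 0
  rw [pow_add_apply, ← dualOp_pow_apply, h1]
  rfl

end Dual

/-! ### Upper triangular operator matrices -/

section Triangular

variable {X Y : Type*} [NormedAddCommGroup X] [NormedSpace ℂ X]
  [NormedAddCommGroup Y] [NormedSpace ℂ Y] {A : X →L[ℂ] X} {B : Y →L[ℂ] Y} {C : Y →L[ℂ] X}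

lemma upperTriangular_sub_smul_id (A : X →L[ℂ] X) (B : Y →L[ℂ] Y) (C : Y →L[ℂ] X) (z : ℂ) :
    upperTriangular A B C - z • ContinuousLinearMap.id ℂ (X × Y) =
      upperTriangular (A - z • ContinuousLinearMap.id ℂ X)
        (B - z • ContinuousLinearMap.id ℂ Y) C := by
  refine ContinuousLinearMap.ext fun v => Prod.ext ?_ rfl
  change A v.1 + C v.2 - z • v.1 = A v.1 - z • v.1 + C v.2
  abel

lemma upperTriangular_apply (v : X × Y) :
    upperTriangular A B C v = (A v.1 + C v.2, B v.2) := rfl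

lemma upperTriangular_pow_apply_fst (n : ℕ) (x : X) :
    ((upperTriangular A B C) ^ n) (x, 0) = ((A ^ n) x, 0) := by
  induction n with
  | zero => rfl
  | succ n ih =>
    rw [add_comm, pow_add_apply, ih, pow_add_apply, pow_one, pow_one, upperTriangular_apply]
    simp

lemma upperTriangular_pow_apply_snd (n : ℕ) (v : X × Y) :
    (((upperTriangular A B C) ^ n) v).2 = (B ^ n) v.2 := by
  induction n with
  | zero => rfl
  | succ n ih =>
    rw [add_comm, pow_add_apply, pow_add_apply, pow_one, pow_one, upperTriangular_apply, ih]

lemma upperTriangular_pow_eq_of_snd_eq_zero {n : ℕ} {v : X × Y} (h : (B ^ n) v.2 = 0) :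
    ∃ x, ((upperTriangular A B C) ^ n) v = (x, 0) :=
  ⟨_, Prod.ext rfl ((upperTriangular_pow_apply_snd n v).trans h)⟩

lemma ascent_lt_top_of_upperTriangular (h : ascent (upperTriangular A B C) < ⊤) :
    ascent A < ⊤ := by
  obtain ⟨p, hp⟩ := (ascent_lt_top_iff _).mp h
  refine (ascent_lt_top_iff A).mpr ⟨p, fun k x hx => ?_⟩
  have := hp k (x, 0) (by rw [upperTriangular_pow_apply_fst, hx]; rfl)
  rw [upperTriangular_pow_apply_fst] at this
  exact congrArg Prod.fst this

lemma descent_lt_top_of_upperTriangular (h : descent (upperTriangular A B C) < ⊤) :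
    descent B < ⊤ := by
  obtain ⟨q, hq⟩ := (descent_lt_top_iff _).mp h
  refine (descent_lt_top_iff B).mpr ⟨q, fun k y => ?_⟩
  obtain ⟨u, hu⟩ := hq k (0, y)
  refine ⟨u.2, ?_⟩
  have := congrArg Prod.snd hu
  rwa [upperTriangular_pow_apply_snd, upperTriangular_pow_apply_snd] at this

lemma ascent_upperTriangular_lt_top (hA : ascent A < ⊤) (hB : ascent B < ⊤) :
    ascent (upperTriangular A B C) < ⊤ := by
  obtain ⟨p, hp⟩ := (ascent_lt_top_iff A).mp hA
  obtain ⟨q, hq⟩ := (ascent_lt_top_iff B).mp hB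
  refine (ascent_lt_top_iff _).mpr ⟨p + q, fun k v hv => ?_⟩
  have hv2 : (B ^ q) v.2 = 0 := hq k _ (by rw [← upperTriangular_pow_apply_snd, hv]; rfl)
  obtain ⟨x, hx⟩ := upperTriangular_pow_eq_of_snd_eq_zero (A := A) (C := C) hv2
  have hx0 : (A ^ k) x = 0 := by
    have : ((upperTriangular A B C) ^ k) (x, 0) = 0 := by
      rw [← hx, ← pow_add_apply, add_comm, pow_add_apply, hv, map_zero]
    rw [upperTriangular_pow_apply_fst] at this
    exact congrArg Prod.fst this
  rw [pow_add_apply, hx, upperTriangular_pow_apply_fst, hp k x hx0]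
  rfl

lemma descent_upperTriangular_lt_top (hA : descent A < ⊤) (hB : descent B < ⊤) :
    descent (upperTriangular A B C) < ⊤ := by
  obtain ⟨p, hp⟩ := (descent_lt_top_iff A).mp hA
  obtain ⟨q, hq⟩ := (descent_lt_top_iff B).mp hB
  refine (descent_lt_top_iff _).mpr ⟨p + q, fun k v => ?_⟩
  obtain ⟨y, hy⟩ := hq (q + k) v.2
  obtain ⟨x, hx⟩ : ∃ x, ((upperTriangular A B C) ^ q) (v - ((upperTriangular A B C) ^ k) (0, y)) =
      (x, 0) := by
    apply upperTriangular_pow_eq_of_snd_eq_zero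
    rw [Prod.snd_sub, upperTriangular_pow_apply_snd, map_sub, ← pow_add_apply, hy, sub_self]
  obtain ⟨u, hu⟩ := hp k x
  refine ⟨(u, 0) + ((upperTriangular A B C) ^ (p + q)) (0, y), ?_⟩
  rw [map_sub, sub_eq_iff_eq_add] at hx
  rw [pow_add_apply, hx, map_add, map_add, upperTriangular_pow_apply_fst,
    upperTriangular_pow_apply_fst, hu]
  simp only [← pow_add_apply]
  rw [← add_assoc, add_comm (p + q)]

/-- If `M_C` has finite descent and `B` finite ascent, then `A` has finite descent: for `x ∈ X`,
every `M_C`-preimage of `A ^ n x` under a power of `M_C` is moved into `X` by a fixed power. -/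
lemma descent_lt_top_of_upperTriangular_of_ascent (hM : descent (upperTriangular A B C) < ⊤)
    (hB : ascent B < ⊤) : descent A < ⊤ := by
  obtain ⟨q, hq⟩ := (descent_lt_top_iff _).mp hM
  obtain ⟨p, hp⟩ := (ascent_lt_top_iff B).mp hB
  refine (descent_lt_top_iff A).mpr ⟨q, fun k x => ?_⟩
  obtain ⟨v, hv⟩ := hq (k + p) (x, 0)
  rw [upperTriangular_pow_apply_fst] at hv
  have hv2 : (B ^ p) v.2 = 0 := hp (k + p) _ (by rw [← upperTriangular_pow_apply_snd, ← hv])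
  obtain ⟨u, hu⟩ := upperTriangular_pow_eq_of_snd_eq_zero (A := A) (C := C) hv2
  rw [pow_add_apply, hu, upperTriangular_pow_apply_fst] at hv
  exact ⟨u, congrArg Prod.fst hv⟩

/-- If `M_C` has finite ascent and `A` finite descent, then `B` has finite ascent: an element of
`N(B ^ k)` lifts to an element of the kernel of some power of `M_C`. -/
lemma ascent_lt_top_of_upperTriangular_of_descent (hM : ascent (upperTriangular A B C) < ⊤)
    (hA : descent A < ⊤) : ascent B < ⊤ := by
  obtain ⟨q, hq⟩ := (descent_lt_top_iff A).mp hA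
  obtain ⟨p, hp⟩ := (ascent_lt_top_iff _).mp hM
  refine (ascent_lt_top_iff B).mpr ⟨p, fun k y hy => ?_⟩
  obtain ⟨x, hx⟩ := upperTriangular_pow_eq_of_snd_eq_zero (A := A) (C := C) (v := (0, y)) hy
  obtain ⟨u, hu⟩ := hq (q + k) x
  have h0 : ((upperTriangular A B C) ^ (q + k)) ((0, y) - (u, 0)) = 0 := by
    rw [map_sub, pow_add_apply, hx, upperTriangular_pow_apply_fst, upperTriangular_pow_apply_fst,
      hu, sub_self]
  have := congrArg Prod.snd (hp _ _ h0)
  rw [upperTriangular_pow_apply_snd] at this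
  simpa using this

lemma fg_ker_upperTriangular (hA : A.ker.FG) (hB : B.ker.FG) : (upperTriangular A B C).ker.FG := by
  refine Submodule.fg_of_fg_map_of_fg_inf_ker (LinearMap.snd ℂ X Y) ?_ ?_
  · refine hB.of_le ?_
    rintro _ ⟨v, hv, rfl⟩
    exact congrArg Prod.snd hv
  · refine (hA.map (LinearMap.inl ℂ X Y)).of_le ?_
    rintro ⟨x, y⟩ ⟨hv, hy⟩
    obtain rfl : y = 0 := hy
    have hv : upperTriangular A B C (x, 0) = 0 := hv
    refine ⟨x, ?_, rfl⟩
    simpa [upperTriangular_apply] using congrArg Prod.fst hv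

lemma fg_ker_of_upperTriangular (h : (upperTriangular A B C).ker.FG) : A.ker.FG := by
  refine Submodule.fg_of_fg_map_injective (LinearMap.inl ℂ X Y) LinearMap.inl_injective
    (h.of_le ?_)
  rintro _ ⟨x, hx, rfl⟩
  have hx : A x = 0 := hx
  change upperTriangular A B C (x, 0) = 0
  rw [upperTriangular_apply, hx, map_zero, map_zero, add_zero]
  rfl

lemma cofg_range_of_upperTriangular (h : (upperTriangular A B C).range.CoFG) : B.range.CoFG := by
  obtain ⟨S, hS⟩ := Submodule.exists_isCompl (upperTriangular A B C).range
  refine ((h.fg_of_isCompl hS).map (LinearMap.snd ℂ X Y)).cofg_of_codisjoint ?_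
  rw [codisjoint_iff, eq_top_iff]
  rintro y -
  obtain ⟨_, ⟨v, rfl⟩, s, hs, hvs⟩ :=
    Submodule.mem_sup.mp (hS.sup_eq_top ▸ Submodule.mem_top : ((0, y) : X × Y) ∈ _)
  refine Submodule.mem_sup.mpr ⟨s.2, ⟨s, hs, rfl⟩, B v.2, ⟨v.2, rfl⟩, ?_⟩
  rw [add_comm]
  exact congrArg Prod.snd hvs

lemma IsBrowder.upperTriangular (hA : IsBrowder A) (hB : IsBrowder B) (C : Y →L[ℂ] X) :
    IsBrowder (upperTriangular A B C) :=
  isBrowder_of_fg_ker (ascent_upperTriangular_lt_top hA.ascent_lt_top hB.ascent_lt_top)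
    (descent_upperTriangular_lt_top hA.2.2 hB.2.2) (fg_ker_upperTriangular hA.fg_ker hB.fg_ker)

/-- If `M_C` is Browder and `B` has finite ascent, then both diagonal entries are Browder. -/
lemma IsBrowder.diagonal_of_ascent (hM : IsBrowder (BrowderTheory.upperTriangular A B C))
    (hB : ascent B < ⊤) : IsBrowder A ∧ IsBrowder B :=
  ⟨isBrowder_of_fg_ker (ascent_lt_top_of_upperTriangular hM.ascent_lt_top)
      (descent_lt_top_of_upperTriangular_of_ascent hM.2.2 hB) (fg_ker_of_upperTriangular hM.fg_ker),
    isBrowder_of_cofg_range hB (descent_lt_top_of_upperTriangular hM.2.2)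
      (cofg_range_of_upperTriangular hM.1.2)⟩

/-- If `M_C` is Browder, then `R(A ^ n)`, being the image of `X` under `M_C ^ n`, inherits from
`M_C` that it is closed for large `n`. -/
lemma IsBrowder.exists_isClosed_range_pow [CompleteSpace X] [CompleteSpace Y]
    (hM : IsBrowder (BrowderTheory.upperTriangular A B C)) :
    ∃ n : ℕ, ∀ m, n ≤ m → IsClosed ((A ^ m).range : Set X) := by
  obtain ⟨n, hn⟩ := hM.exists_isClosed_map
  refine ⟨n, fun m hm => ?_⟩
  have hX : IsClosed ((ContinuousLinearMap.snd ℂ X Y).ker : Set (X × Y)) :=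
    ContinuousLinearMap.isClosed_ker _
  convert (hn m hm _ hX).preimage (ContinuousLinearMap.inl ℂ X Y).continuous
  refine Set.ext fun x => ⟨?_, ?_⟩
  · rintro ⟨u, rfl⟩
    exact ⟨(u, 0), rfl, upperTriangular_pow_apply_fst m u⟩
  · rintro ⟨⟨u, y⟩, hy, hu⟩
    obtain rfl : y = 0 := hy
    have hu : ((BrowderTheory.upperTriangular A B C) ^ m) (u, 0) = (x, 0) := hu
    rw [upperTriangular_pow_apply_fst] at hu
    exact ⟨u, congrArg Prod.fst hu⟩

/-- If `M_C` is Browder, then `A`, its restriction to `X`, inherits the boundedness below on the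
range of a power, and so the dual of `A` has finite descent. -/
lemma IsBrowder.descent_dualOp_lt_top [CompleteSpace X] [CompleteSpace Y]
    (hM : IsBrowder (BrowderTheory.upperTriangular A B C)) : descent (dualOp A) < ⊤ := by
  obtain ⟨n, K, -, hK⟩ := hM.exists_norm_pow_le
  refine BrowderTheory.descent_dualOp_lt_top (n := n) (K := K) fun x => ?_
  have h := hK (x, 0)
  rwa [upperTriangular_pow_apply_fst, upperTriangular_pow_apply_fst, Prod.norm_mk, Prod.norm_mk,
    norm_zero, max_eq_left (norm_nonneg _), max_eq_left (norm_nonneg _)] at h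

/-- The pointwise form of the spectral identity: at each point, its two sides have the same
complement. -/
lemma isBrowder_upperTriangular_and_hasSVEPAt_iff [CompleteSpace X] [CompleteSpace Y]
    (A : X →L[ℂ] X) (B : Y →L[ℂ] Y) (C : Y →L[ℂ] X) (z : ℂ) :
    IsBrowder (upperTriangular A B C - z • ContinuousLinearMap.id ℂ (X × Y)) ∧
        (HasSVEPAt (dualOp A) z ∨ HasSVEPAt B z) ↔
      IsBrowder (A - z • ContinuousLinearMap.id ℂ X) ∧
        IsBrowder (B - z • ContinuousLinearMap.id ℂ Y) := by
  rw [upperTriangular_sub_smul_id]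
  constructor
  · rintro ⟨hM, hsvep | hsvep⟩
    · have hd : descent (dualOp A - z • ContinuousLinearMap.id ℂ _) < ⊤ := by
        rw [dualOp_sub_smul_id]
        exact hM.descent_dualOp_lt_top
      have ha := hsvep.ascent_lt_top hd
      rw [dualOp_sub_smul_id] at ha
      obtain ⟨n, hn⟩ := hM.exists_isClosed_range_pow
      exact hM.diagonal_of_ascent (ascent_lt_top_of_upperTriangular_of_descent hM.ascent_lt_top
        (descent_lt_top_of_ascent_dualOp hn ha))
    · exact hM.diagonal_of_ascent
        (hsvep.ascent_lt_top (descent_lt_top_of_upperTriangular hM.2.2))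
  · rintro ⟨hA, hB⟩
    obtain ⟨n, K, hK, hn⟩ := hB.exists_norm_pow_le
    exact ⟨hA.upperTriangular hB C, Or.inr (hasSVEPAt_of_norm_pow_le hK hn)⟩

end Triangular

end BrowderTheory

theorem theorem3p2 {X Y : Type*}
    [NormedAddCommGroup X] [NormedSpace ℂ X] [CompleteSpace X]
    [NormedAddCommGroup Y] [NormedSpace ℂ Y] [CompleteSpace Y]
    (A : X →L[ℂ] X) (B : Y →L[ℂ] Y) (C : Y →L[ℂ] X) :
    BrowderTheory.browderSpectrum (BrowderTheory.upperTriangular A B C) ∪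
        (BrowderTheory.svepFailureSet (BrowderTheory.dualOp A) ∩
          BrowderTheory.svepFailureSet B) =
      BrowderTheory.browderSpectrum A ∪ BrowderTheory.browderSpectrum B := by
  refine Set.ext fun z => ?_
  have h := BrowderTheory.isBrowder_upperTriangular_and_hasSVEPAt_iff A B C z
  simp only [Set.mem_union, Set.mem_inter_iff, BrowderTheory.browderSpectrum,
    BrowderTheory.svepFailureSet, Set.mem_ofPred_eq]
  tauto
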